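/- **Setting.** Write $^*$ for complex conjugation of scalars, $^\dagger$ for conjugate transposition and $|\cdot|$ for the Euclidean norm. Let $N\ge 2$, let $u_1<u_2<\dots<u_N$ be real, $v_1,\dots,v_N>0$, $k_j=\tfrac12(u_j+iv_j)$, $w_j=-2u_j$, and let $\beta_1,\dots,\beta_N\in\mathbb C^n\setminus\{0\}$. Put $$f_j(k)=\frac{k-k_j}{k-k_j^*},\qquad \phi(x,t,k)=kx+2k^2t,\qquad \Sigma_3=\begin{pmatrix}I_n&0\\0&-1\end{pmatrix}.$$ *Dressing factors.* For vectors $z_1,\dots,z_N$ in some $\mathbb C^m$ and distinct indices $i_1,\dots,i_\ell$ define recursively $$D_{i_1\dots i_\ell}(k)=D_{i_1\dots i_{\ell-1}}(k)\Bigl(I_m+(f_{i_\ell}(k)-1)\Pi_{i_\ell,\{i_1\dots i_{\ell-1}\}}\Bigr),\qquad \Pi_{i_\ell,\{i_1\dots i_{\ell-1}\}}=\frac{\zeta\zeta^\dagger}{\zeta^\dagger\zeta},\quad \zeta=D_{i_1\dots i_{\ell-1}}(k_{i_\ell})^\dagger z_{i_\ell},$$ where the empty product is $I_m$. *The $N$-soliton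 solution* of the vector NLS equation $iR_t+R_{xx}+2RR^\dagger R=0$, $R(x,t)\in\mathbb C^n$, with data $(k_j,\beta_j)_{j\le N}$ is the upper right $n\times1$ block $R(x,t)$ of the $(n+1)\times(n+1)$ matrix $$Q(x,t)=\sum_{j=1}^N i(k_j-k_j^*)\,[\Sigma_3,\Pi_{j,\{1\dots j-1\}}(x,t)],$$ where the projectors are those of the dressing factors for the vectors $z_j=e^{-i\phi(x,t,k_j^*)\Sigma_3}\begin{pmatrix}\beta_j\\-1\end{pmatrix}\in\mathbb C^{n+1}$. *Reduced dressing factors.* $d_{i_1\dots i_\ell}(k)$ denotes the $n\times n$ dressing factor obtained from the vectors $z_j=\beta_j\in\mathbb C^n$. **Proposition.** For $j=1,\dots,N$ let $$\beta_j^{in}=\prod_{\ell=1}^{j-1}f_\ell(k_j^*)\;d_{j+1\dots N}(k_j)^\dagger\beta_j,\qquad \beta_j^{out}=\prod_{\ell=j+1}^{N}f_\ell(k_j^*)\;d_{1\dots j-1}(k_j)^\dagger\beta_j .$$ These vectors are nonzero. Put $\mathbf p_j^{in/out}=\beta_j^{in/out}/|\beta_j^{in/out}|$, $\Delta x_j^{in/out}=\ln|\beta_j^{in/out}|/v_j$,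 $v=\min_jv_j$ and $\tilde w=\min_{l\ne j}|w_l-w_j|$. Then, uniformly in $x\in\mathbb R$, $$R(x,t)=\sum_{j=1}^N\mathbf p_j^{in}\,v_j\,\frac{e^{-i(u_jx+(u_j^2-v_j^2)t)}}{\cosh\bigl(v_j(x-w_jt-\Delta x_j^{in})\bigr)}+O\bigl(e^{-v\tilde w|t|}\bigr)\qquad(t\to-\infty),$$ and, uniformly in $x\in\mathbb R$, the same formula with $\mathbf p_j^{out},\Delta x_j^{out}$ in place of $\mathbf p_j^{in},\Delta x_j^{in}$ holds as $t\to+\infty$. -/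

import Mathlib

open Matrix ComplexConjugate Filter

namespace VNLS

noncomputable section

/-- The spectral parameter `k = (u + i v) / 2`. -/
def pole (u v : ℝ) : ℂ := ((u : ℂ) + Complex.I * (v : ℂ)) / 2

/-- The scalar factor `f_κ(k) = (k - κ) / (k - κ*)`. -/
def blaschke (κ k : ℂ) : ℂ := (k - κ) / (k - conj κ)

/-- The rank-one orthogonal projector `ζ ζ† / (ζ† ζ)` onto the line spanned by `ζ`. -/
def rankOneProj {ι : Type*} [Fintype ι] (ζ : ι → ℂ) : Matrix ι ι ℂ :=
  (star ζ ⬝ᵥ ζ)⁻¹ • vecMulVec ζ (star ζ)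

/-- The degree one dressing factor `I + (f_κ(k) - 1) Π`, where `Π` projects onto `ζ`. -/
def dressingFactor {ι : Type*} [Fintype ι] [DecidableEq ι] (κ : ℂ) (ζ : ι → ℂ) (k : ℂ) :
    Matrix ι ι ℂ :=
  1 + (blaschke κ k - 1) • rankOneProj ζ

/-- The dressing factor attached to poles `κ i`, undressed vectors `z i` and a sequence of indices
`[i₁, …, i_ℓ]`: it starts from the identity matrix and, for each new index `i`, multiplies the
factor `D` obtained so far on the right by the degree one factor with pole `κ i` and vector
`D(κ i)† z i`. -/
def dressing {J ι : Type*} [Fintype ι] [DecidableEq ι] (κ : J → ℂ) (z : J → ι → ℂ)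
    (l : List J) : ℂ → Matrix ι ι ℂ :=
  l.foldl (fun D i k => D k * dressingFactor (κ i) ((D (κ i))ᴴ *ᵥ z i) k) (fun _ => 1)

@[simp] theorem dressing_nil {J ι : Type*} [Fintype ι] [DecidableEq ι] (κ : J → ℂ)
    (z : J → ι → ℂ) (k : ℂ) : dressing κ z [] k = 1 := rfl

/-- The recursion `D_{i₁ … i_ℓ}(k) = D_{i₁ … i_{ℓ-1}}(k) D_{i_ℓ, {i₁ … i_{ℓ-1}}}(k)`. -/
theorem dressing_concat {J ι : Type*} [Fintype ι] [DecidableEq ι] (κ : J → ℂ)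
    (z : J → ι → ℂ) (l : List J) (i : J) (k : ℂ) :
    dressing κ z (l ++ [i]) k =
      dressing κ z l k * dressingFactor (κ i) ((dressing κ z l (κ i))ᴴ *ᵥ z i) k := by
  simp [dressing]

/-- The indices smaller than `j`, in increasing order. -/
def before {N : ℕ} (j : Fin N) : List (Fin N) := (List.finRange N).filter (· < j)

/-- The indices larger than `j`, in increasing order. -/
def after {N : ℕ} (j : Fin N) : List (Fin N) := (List.finRange N).filter (j < ·)

/-! ### The soliton solutions -/

/-- `Σ₃ = diag(1, …, 1, -1)`, of size `n + 1`. -/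
def sigma3 (n : ℕ) : Matrix (Fin n ⊕ Unit) (Fin n ⊕ Unit) ℂ := fromBlocks 1 0 0 (-1)

/-- The phase `φ(x, t, k) = k x + 2 k² t`. -/
def phase (x t : ℝ) (k : ℂ) : ℂ := k * (x : ℂ) + 2 * k ^ 2 * (t : ℂ)

/-- The diagonal matrix `e^{-i θ Σ₃}`. -/
def expSigma3 (n : ℕ) (θ : ℂ) : Matrix (Fin n ⊕ Unit) (Fin n ⊕ Unit) ℂ :=
  diagonal (Sum.elim (fun _ => Complex.exp (-(Complex.I * θ))) (fun _ => Complex.exp (Complex.I * θ)))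

/-- The undressed vector `e^{-i φ(x, t, k*) Σ₃} (β, -1)ᵗ`. -/
def seed {n : ℕ} (k : ℂ) (β : EuclideanSpace ℂ (Fin n)) (x t : ℝ) : Fin n ⊕ Unit → ℂ :=
  expSigma3 n (phase x t (conj k)) *ᵥ Sum.elim (fun a => β a) (fun _ => -1)

/-- The vector `ζ_{j, {1 … j-1}}(x, t) = D_{1 … j-1}(x, t, k_j)† e^{-i φ(x, t, k_j*) Σ₃} (β_j, -1)ᵗ`. -/
def zeta {n N : ℕ} (k : Fin N → ℂ) (β : Fin N → EuclideanSpace ℂ (Fin n)) (x t : ℝ) (j : Fin N) :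
    Fin n ⊕ Unit → ℂ :=
  (dressing k (fun i => seed (k i) (β i) x t) (before j) (k j))ᴴ *ᵥ seed (k j) (β j) x t

/-- The `N`-soliton potential
`Q(x, t) = ∑ⱼ i (k_j - k_j*) [Σ₃, Π_{j, {1 … j-1}}(x, t)]`. -/
def potential {n N : ℕ} (k : Fin N → ℂ) (β : Fin N → EuclideanSpace ℂ (Fin n)) (x t : ℝ) :
    Matrix (Fin n ⊕ Unit) (Fin n ⊕ Unit) ℂ :=
  ∑ j, (Complex.I * (k j - conj (k j))) •
    (sigma3 n * rankOneProj (zeta k β x t j) - rankOneProj (zeta k β x t j) * sigma3 n)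

/-- The `N`-soliton solution `R(x, t)` with poles `k_j` and norming constants `β_j`: the upper right
`n × 1` block of the potential. -/
def nSoliton {n N : ℕ} (k : Fin N → ℂ) (β : Fin N → EuclideanSpace ℂ (Fin n)) (x t : ℝ) :
    EuclideanSpace ℂ (Fin n) :=
  WithLp.toLp 2 fun a => potential k β x t (Sum.inl a) (Sum.inr ())

/-- The polarization `β / |β|` of a norming constant. -/
def polarization {n : ℕ} (β : EuclideanSpace ℂ (Fin n)) : EuclideanSpace ℂ (Fin n) :=
  ((‖β‖ : ℂ)⁻¹) • β

/-- The position `Δx = ln |β| / v` of the maximum of the envelope at `t = 0`. -/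
def position {n : ℕ} (v : ℝ) (β : EuclideanSpace ℂ (Fin n)) : ℝ := Real.log ‖β‖ / v

/-- The velocity `w = -2 u`. -/
def velocity (u : ℝ) : ℝ := -2 * u

/-- The one-soliton solution
`v e^{-i (u x + (u² - v²) t)} / cosh (v (x - w t - Δx)) • 𝐩` with parameters `u`, `v`, `β`. -/
def oneSoliton {n : ℕ} (u v : ℝ) (β : EuclideanSpace ℂ (Fin n)) (x t : ℝ) :
    EuclideanSpace ℂ (Fin n) :=
  ((v : ℂ) * Complex.exp (-(Complex.I * ((u * x + (u ^ 2 - v ^ 2) * t : ℝ) : ℂ))) /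
      (Real.cosh (v * (x - velocity u * t - position v β)) : ℂ)) • polarization β

/-! ### The asymptotic norming constants -/

/-- The reduced dressing factor `d_{i₁ … i_ℓ}(k)`, of size `n`. -/
def reducedDressing {n N : ℕ} (k : Fin N → ℂ) (β : Fin N → EuclideanSpace ℂ (Fin n))
    (l : List (Fin N)) : ℂ → Matrix (Fin n) (Fin n) ℂ :=
  dressing k (fun i a => β i a) l

/-- `β_j^{in} = ∏_{ℓ < j} f_ℓ(k_j*) d_{j+1 … N}(k_j)† β_j`. -/
def betaIn {n N : ℕ} (k : Fin N → ℂ) (β : Fin N → EuclideanSpace ℂ (Fin n)) (j : Fin N) :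
    EuclideanSpace ℂ (Fin n) :=
  WithLp.toLp 2 ((∏ l ∈ Finset.Iio j, blaschke (k l) (conj (k j))) •
    ((reducedDressing k β (after j) (k j))ᴴ *ᵥ fun a => β j a))

/-- `β_j^{out} = ∏_{ℓ > j} f_ℓ(k_j*) d_{1 … j-1}(k_j)† β_j`. -/
def betaOut {n N : ℕ} (k : Fin N → ℂ) (β : Fin N → EuclideanSpace ℂ (Fin n)) (j : Fin N) :
    EuclideanSpace ℂ (Fin n) :=
  WithLp.toLp 2 ((∏ l ∈ Finset.Ioi j, blaschke (k l) (conj (k j))) •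
    ((reducedDressing k β (before j) (k j))ᴴ *ᵥ fun a => β j a))

/-- The smallest amplitude `v = min_j v_j`. -/
def minAmplitude {N : ℕ} (v : Fin N → ℝ) : ℝ := ⨅ j, v j

/-- The smallest relative speed `w̃ = min_{l ≠ j} |w_l - w_j|`. -/
def minRelativeSpeed {N : ℕ} (u : Fin N → ℝ) : ℝ :=
  ⨅ p : {p : Fin N × Fin N // p.1 ≠ p.2}, |velocity (u p.1.1) - velocity (u p.1.2)|

end

end VNLS

namespace VNLS

/-! ### Rank-one projectors and degree one factors. -/

section Factor

variable {ι : Type*} [Fintype ι]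

/-! The potential is read off the `1 / k` coefficient at infinity of the full dressing factor. That
factor depends only on the lines spanned by the seeds (`superposition_smul`) and not on the order of
the poles (`dressing_perm`). For given `x`, `t`, the line of the `j`-th seed is near `(β_j, 0)` if
`x ≤ w_j t` and near `(0, -1)` otherwise. In the chart `p` of lines chosen by these signs, its
coordinate `c_j` has modulus `exp (-v_j |x - w_j t|)` (`norm_seedCoord`).

In each of the finitely many charts the solution is a `C²` function `F_p` of `c`. It vanishes at `c
= 0`, where every dressing factor is block diagonal (`dressing_background`). A Taylor-type estimate
gives `F_p c = ∑ l, F_p (c_l e_l) + O(max_{i ≠ j} |c_i| |c_j|)` (`exists_norm_sub_sum_single_le`),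
and by the triangle inequality these products are at most `exp (-v w̃ |t|)`. Each `F_p (c_l e_l)` is
exactly a one-soliton: moving the pole `l` to the end of the product leaves its seed multiplied by a
constant block diagonal matrix, which only changes its norming constant
(`superposition_eq_oneSoliton`).

The norming constant still depends on `p`, hence on `x`. If `p` differs from the ordering expected
as `t → ±∞` at some `m ≠ l`, then `x` is at distance at least `w̃ |t|` from `w_l t`. Both the actual
and the expected soliton `l` are then within the error term (`exists_norm_nSoliton_sub_le`). -/

theorem rankOneProj_smul {c : ℂ} (hc : c ≠ 0) (ζ : ι → ℂ) :
    rankOneProj (c • ζ) = rankOneProj ζ := by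
  have hc' : conj c ≠ 0 := by simpa using hc
  ext a b
  simp only [rankOneProj, star_smul, smul_dotProduct, dotProduct_smul, Matrix.smul_apply,
    vecMulVec_apply, Pi.smul_apply, smul_eq_mul, RCLike.star_def, mul_inv]
  field_simp

open scoped ComplexOrder in
theorem dotProduct_star_self_ne_zero {ζ : ι → ℂ} (h : ζ ≠ 0) : star ζ ⬝ᵥ ζ ≠ 0 := by
  rwa [ne_eq, dotProduct_star_self_eq_zero]

theorem rankOneProj_mul_self (ζ : ι → ℂ) : rankOneProj ζ * rankOneProj ζ = rankOneProj ζ := by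
  by_cases h : ζ = 0
  · subst h; simp [rankOneProj]
  have h1 := dotProduct_star_self_ne_zero h
  simp only [rankOneProj, Matrix.smul_mul, Matrix.mul_smul, vecMulVec_mul_vecMulVec, smul_smul,
    vecMulVec_smul]
  congr 1
  field_simp

theorem conjTranspose_rankOneProj (ζ : ι → ℂ) : (rankOneProj ζ)ᴴ = rankOneProj ζ := by
  ext a b
  have h : conj (star ζ ⬝ᵥ ζ) = star ζ ⬝ᵥ ζ := by
    simp [dotProduct, mul_comm]
  simp only [rankOneProj, conjTranspose_apply, Matrix.smul_apply, vecMulVec_apply, Pi.star_apply,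
    smul_eq_mul, RCLike.star_def, map_mul, map_inv₀, h, Complex.conj_conj]
  ring

theorem rankOneProj_mulVec (ζ w : ι → ℂ) :
    rankOneProj ζ *ᵥ w = ((star ζ ⬝ᵥ ζ)⁻¹ * (star ζ ⬝ᵥ w)) • ζ := by
  ext a
  simp only [rankOneProj, smul_mulVec, vecMulVec_mulVec, Pi.smul_apply, smul_eq_mul,
    MulOpposite.smul_eq_mul_unop, MulOpposite.unop_op]
  ring

variable [DecidableEq ι]

theorem dressingFactor_smul {c : ℂ} (hc : c ≠ 0) (κ : ℂ) (ζ : ι → ℂ) (k : ℂ) :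
    dressingFactor κ (c • ζ) k = dressingFactor κ ζ k := by
  rw [dressingFactor, rankOneProj_smul hc, dressingFactor]

/-- Since the projector is idempotent, the inverse is obtained by replacing `f` with `1 / f`. -/
theorem isUnit_dressingFactor {κ k : ℂ} (h : blaschke κ k ≠ 0) (ζ : ι → ℂ) :
    IsUnit (dressingFactor κ ζ k) := by
  refine IsUnit.of_mul_eq_one (1 + ((blaschke κ k)⁻¹ - 1) • rankOneProj ζ) ?_
  simp only [dressingFactor, add_mul, mul_add, one_mul, mul_one, Matrix.smul_mul, Matrix.mul_smul,
    rankOneProj_mul_self, smul_smul]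
  rw [add_assoc, ← add_smul, ← add_smul]
  convert add_zero _ using 2
  convert zero_smul ℂ _ using 2
  field_simp
  ring

theorem conjTranspose_mulVec_ne_zero {D : Matrix ι ι ℂ} (hD : IsUnit D) {z : ι → ℂ} (hz : z ≠ 0) :
    Dᴴ *ᵥ z ≠ 0 := by
  have h : IsUnit Dᴴ := by simpa [star_eq_conjTranspose] using hD.star
  intro h0
  exact hz (mulVec_injective_of_isUnit h (by simpa using h0))

theorem conjTranspose_dressingFactor_mulVec (κ k : ℂ) (ζ w : ι → ℂ) :
    (dressingFactor κ ζ k)ᴴ *ᵥ w =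
      w + ((conj (blaschke κ k) - 1) * ((star ζ ⬝ᵥ ζ)⁻¹ * (star ζ ⬝ᵥ w))) • ζ := by
  simp [dressingFactor, conjTranspose_add, conjTranspose_smul, conjTranspose_rankOneProj,
    add_mulVec, smul_mulVec, rankOneProj_mulVec, smul_smul]

end Factor

theorem sub_conj_ne_zero {κ k : ℂ} (hκ : 0 < κ.im) (hk : 0 < k.im) : k - conj κ ≠ 0 := by
  intro h
  have := congrArg Complex.im h
  simp at this
  linarith

theorem blaschke_ne_zero {κ k : ℂ} (hκ : 0 < κ.im) (hk : 0 < k.im) (h : k ≠ κ) :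
    blaschke κ k ≠ 0 :=
  div_ne_zero (sub_ne_zero.2 h) (sub_conj_ne_zero hκ hk)

theorem conj_blaschke (κ k : ℂ) : conj (blaschke κ k) = (blaschke κ (conj k))⁻¹ := by
  simp [blaschke]

/-! ### Exchange of two poles. -/

section Swap

variable {ι : Type*} [Fintype ι] [DecidableEq ι]

/-- The product of two degree one factors does not depend on their order. -/
theorem dressingFactor_mul_comm {κ₁ κ₂ : ℂ} (h₁ : 0 < κ₁.im) (h₂ : 0 < κ₂.im) (h : κ₁ ≠ κ₂)
    (a b : ι → ℂ) {k : ℂ} (hk₁ : k - conj κ₁ ≠ 0) (hk₂ : k - conj κ₂ ≠ 0) :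
    dressingFactor κ₁ a k * dressingFactor κ₂ ((dressingFactor κ₁ a κ₂)ᴴ *ᵥ b) k =
      dressingFactor κ₂ b k * dressingFactor κ₁ ((dressingFactor κ₂ b κ₁)ᴴ *ᵥ a) k := by
  by_cases ha : a = 0
  · subst ha; simp [dressingFactor, rankOneProj]
  by_cases hb : b = 0
  · subst hb; simp [dressingFactor, rankOneProj]
  have ha' := dotProduct_star_self_ne_zero ha
  have hb' := dotProduct_star_self_ne_zero hb
  have hab := dotProduct_star_self_ne_zero (conjTranspose_mulVec_ne_zero
    (isUnit_dressingFactor (blaschke_ne_zero h₁ h₂ h.symm) a) hb)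
  have e12 := sub_conj_ne_zero h₁ h₂
  have e21 := sub_conj_ne_zero h₂ h₁
  have e12' : conj κ₂ - κ₁ ≠ 0 := by simpa using (map_ne_zero (starRingEnd ℂ)).2 e12
  have e21' : conj κ₁ - κ₂ ≠ 0 := by simpa using (map_ne_zero (starRingEnd ℂ)).2 e21
  rw [conjTranspose_dressingFactor_mulVec] at hab ⊢
  rw [conjTranspose_dressingFactor_mulVec]
  have hα : conj (star a ⬝ᵥ a) = star a ⬝ᵥ a := by simp [dotProduct, mul_comm]
  have hβ : conj (star b ⬝ᵥ b) = star b ⬝ᵥ b := by simp [dotProduct, mul_comm]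
  have hγ : conj (star a ⬝ᵥ b) = star b ⬝ᵥ a := by simp [dotProduct, mul_comm]
  have hγ' : conj (star b ⬝ᵥ a) = star a ⬝ᵥ b := by simp [dotProduct, mul_comm]
  simp only [dressingFactor, rankOneProj, blaschke, star_add, star_smul, add_dotProduct,
    dotProduct_add, smul_dotProduct, dotProduct_smul, RCLike.star_def, smul_eq_mul, map_mul,
    map_sub, map_div₀, map_inv₀, map_one, Complex.conj_conj, hα, hβ, hγ, hγ', add_mul, mul_add,
    one_mul, mul_one, Matrix.smul_mul, Matrix.mul_smul, add_vecMulVec, vecMulVec_add,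
    smul_vecMulVec, vecMulVec_smul, vecMulVec_mul_vecMulVec, smul_add, smul_smul] at hab ⊢
  -- From here on conjugates and inner products are independent variables: the claim is a rational
  -- identity for the coefficients of the four rank-one matrices built from `a` and `b`.
  generalize star a ⬝ᵥ a = α at *
  generalize star b ⬝ᵥ b = β at *
  generalize star a ⬝ᵥ b = γ at *
  generalize star b ⬝ᵥ a = γ' at *
  generalize conj κ₁ = μ₁ at *
  generalize conj κ₂ = μ₂ at *
  -- `Δ` is the common numerator of the squared norms of the two dressed vectors. It is invariant
  -- under exchanging the two poles, so both sides acquire the same denominator.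
  obtain ⟨Δ, hΔ⟩ : ∃ Δ, Δ = α * β * ((κ₂ - μ₁) * (μ₂ - κ₁)) + (κ₂ - μ₂) * (κ₁ - μ₁) * (γ * γ') :=
    ⟨_, rfl⟩
  have hE : β + ((κ₂ - κ₁) / (κ₂ - μ₁) - 1) * (α⁻¹ * γ') * γ +
      (((μ₂ - μ₁) / (μ₂ - κ₁) - 1) * (α⁻¹ * γ) * γ' + ((μ₂ - μ₁) / (μ₂ - κ₁) - 1) * (α⁻¹ * γ) *
        (((κ₂ - κ₁) / (κ₂ - μ₁) - 1) * (α⁻¹ * γ') * α)) =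
      Δ / (α * ((κ₂ - μ₁) * (μ₂ - κ₁))) := by
    rw [hΔ]; field_simp; ring
  have hE' : α + ((κ₁ - κ₂) / (κ₁ - μ₂) - 1) * (β⁻¹ * γ) * γ' +
      (((μ₁ - μ₂) / (μ₁ - κ₂) - 1) * (β⁻¹ * γ') * γ + ((μ₁ - μ₂) / (μ₁ - κ₂) - 1) * (β⁻¹ * γ') *
        (((κ₁ - κ₂) / (κ₁ - μ₂) - 1) * (β⁻¹ * γ) * β)) =
      Δ / (β * ((κ₁ - μ₂) * (μ₁ - κ₂))) := by
    rw [hΔ]; field_simp; ring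
  rw [hE] at hab ⊢
  rw [hE']
  have hΔ0 : Δ ≠ 0 := by
    rintro rfl; simp at hab
  match_scalars
  all_goals field_simp
  all_goals try rw [hΔ]
  all_goals ring

end Swap

/-! ### Dressing factors along a list of poles. -/

section List

variable {J ι : Type*} [Fintype ι] [DecidableEq ι] (κ : J → ℂ)

/-- Peeling off the first factor, whereas the definition peels off the last. The remaining vectors
absorb the first factor, because `(A B)† = B† A†`. Permutations can then be treated by induction on
the list. -/
theorem dressing_cons (z : J → ι → ℂ) (i : J) (l : List J) (k : ℂ) :
    dressing κ z (i :: l) k = dressingFactor (κ i) (z i) k *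
      dressing κ (fun m => (dressingFactor (κ i) (z i) (κ m))ᴴ *ᵥ z m) l k := by
  induction l using List.reverseRecOn generalizing k with
  | nil =>
    have := dressing_concat κ z [] i k
    simpa using this
  | append_singleton l j ih =>
    rw [← List.cons_append, dressing_concat, dressing_concat, ih, ih, Matrix.mul_assoc,
      conjTranspose_mul, mulVec_mulVec]

theorem dressing_congr {z z' : J → ι → ℂ} {l : List J} (h : ∀ i ∈ l, z i = z' i) (k : ℂ) :
    dressing κ z l k = dressing κ z' l k := by
  induction l using List.reverseRecOn generalizing k with
  | nil => rw [dressing_nil, dressing_nil]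
  | append_singleton l j ih =>
    have h1 := ih fun i hi => h i (by simp [hi])
    rw [dressing_concat, dressing_concat, h1, h1, h j (by simp)]

theorem dressing_smul (c : J → ℂ) (hc : ∀ j, c j ≠ 0) (z : J → ι → ℂ) (l : List J) (k : ℂ) :
    dressing κ (fun j => c j • z j) l k = dressing κ z l k := by
  induction l using List.reverseRecOn generalizing k with
  | nil => rw [dressing_nil, dressing_nil]
  | append_singleton l j ih =>
    rw [dressing_concat, dressing_concat, ih, ih, mulVec_smul, dressingFactor_smul (hc j)]

variable {κ}

/-- The dressing factor does not depend on the order in which the poles are added. -/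
theorem dressing_perm (hκ : ∀ j, 0 < (κ j).im) (hinj : Function.Injective κ) (z : J → ι → ℂ)
    {l l' : List J} (h : l.Perm l') {k : ℂ} (hk : ∀ j, k - conj (κ j) ≠ 0) :
    dressing κ z l k = dressing κ z l' k := by
  induction h generalizing z with
  | nil => rfl
  | cons i _ ih => rw [dressing_cons, dressing_cons, ih]
  | trans _ _ ih₁ ih₂ => rw [ih₁, ih₂]
  | swap i j l =>
    by_cases hij : i = j
    · rw [hij]
    have key := fun k h1 h2 => dressingFactor_mul_comm (hκ j) (hκ i)
      (fun h => hij (hinj h).symm) (z j) (z i) (k := k) h1 h2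
    simp only [dressing_cons, ← Matrix.mul_assoc, mulVec_mulVec, ← conjTranspose_mul]
    rw [key k (hk j) (hk i)]
    -- The tail also sees the vectors transformed by the first two factors. These agree by the same
    -- exchange identity at `k = κ m`.
    congr 2
    funext m
    rw [key (κ m) (sub_conj_ne_zero (hκ j) (hκ m)) (sub_conj_ne_zero (hκ i) (hκ m))]

theorem isUnit_dressing (hκ : ∀ j, 0 < (κ j).im) (z : J → ι → ℂ) {l : List J} {k : ℂ}
    (hk : 0 < k.im) (h : ∀ i ∈ l, k ≠ κ i) : IsUnit (dressing κ z l k) := by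
  induction l generalizing z with
  | nil => simp
  | cons i l ih =>
    rw [dressing_cons]
    exact (isUnit_dressingFactor (blaschke_ne_zero (hκ i) hk (h i (by simp))) _).mul
      (ih _ fun j hj => h j (by simp [hj]))

end List

/-! ### Expansion at infinity. -/

section Limit

variable {ι : Type*} [Fintype ι] [DecidableEq ι]

/-- Comes from `f(s) - 1 = (κ* - κ) / (s - κ*)`. Letting `s` be real keeps it away from all poles.
-/
theorem tendsto_mul_blaschke_sub_one {κ : ℂ} (hκ : 0 < κ.im) :
    Tendsto (fun s : ℝ => (s : ℂ) * (blaschke κ s - 1)) atTop (nhds (conj κ - κ)) := by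
  have h0 : Tendsto (fun s : ℝ => (1 - conj κ * ((s⁻¹ : ℝ) : ℂ))) atTop (nhds (1 - conj κ * (0 : ℝ))) :=
    tendsto_const_nhds.sub (tendsto_const_nhds.mul
      ((Complex.continuous_ofReal.tendsto 0).comp tendsto_inv_atTop_zero))
  have h1 : Tendsto (fun s : ℝ => (conj κ - κ) / (1 - conj κ * ((s⁻¹ : ℝ) : ℂ))) atTop
      (nhds ((conj κ - κ) / (1 - conj κ * (0 : ℝ)))) :=
    tendsto_const_nhds.div h0 (by simp)
  simp only [Complex.ofReal_zero, mul_zero, sub_zero, div_one] at h1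
  refine h1.congr' ?_
  filter_upwards [eventually_gt_atTop 0] with s hs
  have hs' : (s : ℂ) ≠ 0 := by exact_mod_cast hs.ne'
  have h2 : (s : ℂ) - conj κ ≠ 0 := by
    intro h
    have := congrArg Complex.im h
    simp at this
    exact hκ.ne' this
  have h3 : 1 - conj κ * ((s⁻¹ : ℝ) : ℂ) = (s - conj κ) / s := by
    push_cast; field_simp
  rw [h3, blaschke]
  field_simp
  ring

omit [Fintype ι] in
theorem tendsto_of_residue {D : ℝ → Matrix ι ι ℂ} {S : Matrix ι ι ℂ}
    (h : Tendsto (fun s : ℝ => (s : ℂ) • (D s - 1)) atTop (nhds S)) : Tendsto D atTop (nhds 1) := by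
  have h0 : Tendsto (fun s : ℝ => ((s⁻¹ : ℝ) : ℂ)) atTop (nhds ((0 : ℝ) : ℂ)) :=
    (Complex.continuous_ofReal.tendsto 0).comp tendsto_inv_atTop_zero
  have h1 := (h0.smul h).add_const (1 : Matrix ι ι ℂ)
  simp only [Complex.ofReal_zero, zero_smul, zero_add] at h1
  refine h1.congr' ?_
  filter_upwards [eventually_gt_atTop 0] with s hs
  have hs' : (s : ℂ) ≠ 0 := by exact_mod_cast hs.ne'
  rw [smul_smul]
  push_cast
  rw [inv_mul_cancel₀ hs', one_smul, sub_add_cancel]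

/-- Both factors tend to the identity, so their `1 / k` coefficients add. -/
theorem tendsto_residue_mul_dressingFactor {D : ℝ → Matrix ι ι ℂ} {S : Matrix ι ι ℂ} {κ : ℂ}
    (hκ : 0 < κ.im) (ζ : ι → ℂ)
    (h : Tendsto (fun s : ℝ => (s : ℂ) • (D s - 1)) atTop (nhds S)) :
    Tendsto (fun s : ℝ => (s : ℂ) • (D s * dressingFactor κ ζ s - 1)) atTop
      (nhds (S + (conj κ - κ) • rankOneProj ζ)) := by
  have h2 : Tendsto (fun s : ℝ => D s * (((s : ℂ) * (blaschke κ s - 1)) • rankOneProj ζ)) atTop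
      (nhds (1 * ((conj κ - κ) • rankOneProj ζ))) :=
    (tendsto_of_residue h).mul ((tendsto_mul_blaschke_sub_one hκ).smul_const (rankOneProj ζ))
  rw [one_mul] at h2
  refine (h.add h2).congr fun s => ?_
  rw [dressingFactor, mul_add, mul_one, Matrix.mul_smul, Matrix.mul_smul, ← smul_smul, ← smul_add]
  congr 1
  abel

end Limit

/-! ### Block diagonal dressing. -/

section Background

variable {ι : Type*} [Fintype ι] [DecidableEq ι]

theorem dressingFactor_elim_zero (κ : ℂ) (w : ι → ℂ) (k : ℂ) :
    dressingFactor κ (Sum.elim w (0 : Unit → ℂ)) k = fromBlocks (dressingFactor κ w k) 0 0 1 := by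
  ext (a | a) (b | b) <;>
    simp [dressingFactor, rankOneProj, vecMulVec_apply, dotProduct, Matrix.one_apply]

theorem dressingFactor_zero_elim (κ : ℂ) {c : ℂ} (hc : c ≠ 0) (k : ℂ) :
    dressingFactor κ (Sum.elim (0 : ι → ℂ) (fun _ : Unit => c)) k =
      fromBlocks 1 0 0 (blaschke κ k • 1) := by
  have : conj c ≠ 0 := by simpa using hc
  ext (a | a) (b | b)
  · simp [dressingFactor, rankOneProj, vecMulVec_apply, dotProduct, Matrix.one_apply]
  · simp [dressingFactor, rankOneProj, vecMulVec_apply, dotProduct]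
  · simp [dressingFactor, rankOneProj, vecMulVec_apply, dotProduct]
  · simp [dressingFactor, rankOneProj, vecMulVec_apply, dotProduct]
    field_simp
    ring

/-- The limiting vectors: the first block survives for the indices selected by `p`, and the last
coordinate for the others. -/
noncomputable def background {J : Type*} (p : J → Bool) (β : J → ι → ℂ) (j : J) : ι ⊕ Unit → ℂ :=
  if p j then Sum.elim (β j) 0 else Sum.elim 0 (fun _ => -1)

/-- Each vector lies in one of the two blocks and block diagonal matrices keep it there. A vector in
the first block contributes a reduced factor, one in the last coordinate only a scalar `f` there, so
the two groups of poles decouple. -/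
theorem dressing_background {J : Type*} {κ : J → ℂ} (hκ : ∀ j, 0 < (κ j).im)
    (hinj : Function.Injective κ) (p : J → Bool) (β : J → ι → ℂ) {l : List J} (hl : l.Nodup)
    (k : ℂ) :
    dressing κ (background p β) l k = fromBlocks (dressing κ β (l.filter fun i => p i) k) 0 0
      (((l.filter fun i => !p i).map fun i => blaschke (κ i) k).prod • 1) := by
  induction l using List.reverseRecOn generalizing k with
  | nil => simp [fromBlocks_one]
  | append_singleton l j ih =>
    have hl' := List.nodup_append.1 hl
    have ih' := ih hl'.1
    have hj : ∀ i ∈ l, κ j ≠ κ i := fun i hi h => hl'.2.2 i hi j (by simp) (hinj h).symm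
    rw [dressing_concat, ih', ih']
    by_cases hp : p j
    · have hv : (fromBlocks (dressing κ β (l.filter fun i => p i) (κ j)) 0 0
          (((l.filter fun i => !p i).map fun i => blaschke (κ i) (κ j)).prod •
            (1 : Matrix Unit Unit ℂ)))ᴴ *ᵥ background p β j =
          Sum.elim ((dressing κ β (l.filter fun i => p i) (κ j))ᴴ *ᵥ β j) 0 := by
        rw [background, if_pos hp, fromBlocks_conjTranspose, fromBlocks_mulVec]
        simp
      rw [hv, dressingFactor_elim_zero, fromBlocks_multiply]
      simp [hp, dressing_concat]
    · have hv : (fromBlocks (dressing κ β (l.filter fun i => p i) (κ j)) 0 0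
          (((l.filter fun i => !p i).map fun i => blaschke (κ i) (κ j)).prod •
            (1 : Matrix Unit Unit ℂ)))ᴴ *ᵥ background p β j =
          Sum.elim (0 : ι → ℂ) (fun _ =>
            -conj ((l.filter fun i => !p i).map fun i => blaschke (κ i) (κ j)).prod) := by
        rw [background, if_neg hp, fromBlocks_conjTranspose, fromBlocks_mulVec]
        ext (a | a)
        · simp
        · simp [conjTranspose_smul, smul_mulVec]
      -- Distinctness of the poles enters here: a repeated pole would annihilate the vector and make
      -- its projector zero.
      have h0 : -conj ((l.filter fun i => !p i).map fun i => blaschke (κ i) (κ j)).prod ≠ 0 := by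
        rw [neg_ne_zero, map_ne_zero]
        refine List.prod_ne_zero ?_
        simp only [List.mem_map, List.mem_filter, not_exists, not_and]
        exact fun i hi => blaschke_ne_zero (hκ i) (hκ j) (hj i hi.1)
      rw [hv, dressingFactor_zero_elim _ h0, fromBlocks_multiply]
      simp [hp, smul_smul, mul_comm]

end Background

/-! ### The coefficient of `1 / k`. -/

section Residue

variable {ι : Type*} [Fintype ι] [DecidableEq ι] {N : ℕ}

/-- The coefficient of `1 / k` in the expansion of the dressing factor at infinity. -/
noncomputable def residue (κ : Fin N → ℂ) (z : Fin N → ι → ℂ) : Matrix ι ι ℂ :=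
  ∑ j, (conj (κ j) - κ j) • rankOneProj ((dressing κ z (before j) (κ j))ᴴ *ᵥ z j)

theorem before_eq_take (j : Fin N) : before j = (List.finRange N).take j := by
  have h1 : (List.finRange N).filter (· < j) =
      ((List.finRange N).take j ++ (List.finRange N).drop j).filter (· < j) := by
    rw [List.take_append_drop]
  rw [before, h1, List.filter_append, List.filter_eq_self.2, List.filter_eq_nil_iff.2,
    List.append_nil]
  · intro i hi
    obtain ⟨m, hm, rfl⟩ := List.mem_drop_iff_getElem.1 hi
    simp [Fin.lt_def]
  · intro i hi
    obtain ⟨m, hm, rfl⟩ := List.mem_take_iff_getElem.1 hi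
    simp [Fin.lt_def]
    omega

/-- Identifies the sum of projectors, which refers to an ordering, with a limit of the full dressing
factor, which does not. The soliton potential thereby inherits `dressing_perm`. -/
theorem tendsto_residue {κ : Fin N → ℂ} (hκ : ∀ j, 0 < (κ j).im) (z : Fin N → ι → ℂ) :
    Tendsto (fun s : ℝ => (s : ℂ) • (dressing κ z (List.finRange N) s - 1)) atTop
      (nhds (residue κ z)) := by
  have key : ∀ m ≤ N, Tendsto (fun s : ℝ => (s : ℂ) •
      (dressing κ z ((List.finRange N).take m) s - 1)) atTop
      (nhds (∑ j with j.val < m, (conj (κ j) - κ j) •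
        rankOneProj ((dressing κ z (before j) (κ j))ᴴ *ᵥ z j))) := by
    intro m
    induction m with
    | zero => simp
    | succ m ih =>
      intro hm
      have h1 : (List.finRange N).take (m + 1) = (List.finRange N).take m ++ [⟨m, hm⟩] := by
        rw [List.take_add_one]
        simp [Nat.lt_of_succ_le hm]
      have h2 : (Finset.univ.filter fun j : Fin N => j.val < m + 1) =
          insert ⟨m, hm⟩ (Finset.univ.filter fun j : Fin N => j.val < m) := by
        ext j
        simp [Fin.ext_iff]
        omega
      rw [h1, h2, Finset.sum_insert (by simp), add_comm]
      simp only [dressing_concat]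
      have := tendsto_residue_mul_dressingFactor (hκ ⟨m, hm⟩)
        ((dressing κ z (before ⟨m, hm⟩) (κ ⟨m, hm⟩))ᴴ *ᵥ z ⟨m, hm⟩) (ih (Nat.le_of_succ_le hm))
      rwa [before_eq_take] at this ⊢
  have := key N le_rfl
  simpa [List.take_of_length_le, residue] using this

theorem real_sub_conj_ne_zero {κ : ℂ} (hκ : 0 < κ.im) (s : ℝ) : (s : ℂ) - conj κ ≠ 0 := by
  intro h
  have := congrArg Complex.im h
  simp at this
  exact hκ.ne' this

theorem exists_residue {J : Type*} {κ : J → ℂ} (hκ : ∀ j, 0 < (κ j).im) (z : J → ι → ℂ)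
    (l : List J) : ∃ S, Tendsto (fun s : ℝ => (s : ℂ) • (dressing κ z l s - 1)) atTop (nhds S) := by
  induction l using List.reverseRecOn with
  | nil => exact ⟨0, by simp⟩
  | append_singleton l j ih =>
    obtain ⟨S, hS⟩ := ih
    simp only [dressing_concat]
    exact ⟨_, tendsto_residue_mul_dressingFactor (hκ j) _ hS⟩

theorem exists_residue_background {J : Type*} {κ : J → ℂ} (hκ : ∀ j, 0 < (κ j).im)
    (hinj : Function.Injective κ) (p : J → Bool) (β : J → ι → ℂ) {l : List J} (hl : l.Nodup) :
    ∃ S, Tendsto (fun s : ℝ => (s : ℂ) • (dressing κ (background p β) l s - 1)) atTop (nhds S) ∧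
      ∀ a, S (Sum.inl a) (Sum.inr ()) = 0 := by
  obtain ⟨S, hS⟩ := exists_residue hκ (background p β) l
  refine ⟨S, hS, fun a => ?_⟩
  have h := ((continuous_id.matrix_elem (Sum.inl a) (Sum.inr ())).tendsto S).comp hS
  refine tendsto_nhds_unique h ?_
  refine tendsto_const_nhds.congr fun s => ?_
  simp [dressing_background hκ hinj p β hl]

theorem residue_background {κ : Fin N → ℂ} (hκ : ∀ j, 0 < (κ j).im)
    (hinj : Function.Injective κ) (p : Fin N → Bool) (β : Fin N → ι → ℂ) (a : ι) :
    residue κ (background p β) (Sum.inl a) (Sum.inr ()) = 0 := by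
  obtain ⟨S, hS, h0⟩ := exists_residue_background hκ hinj p β (List.nodup_finRange N)
  rw [tendsto_nhds_unique (tendsto_residue hκ _) hS, h0]

/-- With the pole `l` placed last, the earlier factors form a block diagonal matrix with no
off-diagonal residue. Only the last projector contributes. -/
theorem residue_of_eq_background {κ : Fin N → ℂ} (hκ : ∀ j, 0 < (κ j).im)
    (hinj : Function.Injective κ) {p : Fin N → Bool} {β : Fin N → ι → ℂ}
    {z : Fin N → ι ⊕ Unit → ℂ} {l : Fin N} (hz : ∀ m, m ≠ l → z m = background p β m) (a : ι) :
    residue κ z (Sum.inl a) (Sum.inr ()) = (conj (κ l) - κ l) *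
      rankOneProj ((dressing κ (background p β) ((List.finRange N).filter (· ≠ l)) (κ l))ᴴ *ᵥ z l)
        (Sum.inl a) (Sum.inr ()) := by
  have hcongr : ∀ k, dressing κ z ((List.finRange N).filter (· ≠ l)) k =
      dressing κ (background p β) ((List.finRange N).filter (· ≠ l)) k :=
    dressing_congr κ (fun i hi => hz i (by simpa using hi))
  have hperm : (List.finRange N).Perm ((List.finRange N).filter (· ≠ l) ++ [l]) := by
    refine (List.perm_ext_iff_of_nodup (List.nodup_finRange N) ?_).2 ?_
    · refine List.nodup_append.2 ⟨(List.nodup_finRange N).filter _, by simp, ?_⟩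
      simp
    · intro i
      simp [em']
  obtain ⟨S, hS, h0⟩ := exists_residue_background hκ hinj p β
    ((List.nodup_finRange N).filter (· ≠ l))
  have h1 := tendsto_residue_mul_dressingFactor (hκ l)
    ((dressing κ (background p β) ((List.finRange N).filter (· ≠ l)) (κ l))ᴴ *ᵥ z l) hS
  have h2 := tendsto_residue hκ z
  have h3 := h1.congr (f₂ := fun s : ℝ => (s : ℂ) • (dressing κ z (List.finRange N) s - 1)) fun s => by
    rw [dressing_perm hκ hinj z hperm (fun j => real_sub_conj_ne_zero (hκ j) s), dressing_concat,
      hcongr, hcongr]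
  rw [tendsto_nhds_unique h2 h3]
  simp [h0]

end Residue

/-! ### From residues to solitons. -/

section Soliton

variable {n N : ℕ}

/-- The vector field read off the `1 / k` coefficient of a dressing factor. -/
noncomputable def superposition (κ : Fin N → ℂ) (z : Fin N → Fin n ⊕ Unit → ℂ) :
    EuclideanSpace ℂ (Fin n) :=
  WithLp.toLp 2 fun a => -(2 * Complex.I) * residue κ z (Sum.inl a) (Sum.inr ())

/-- The commutator with `Σ₃` doubles the upper right block, and `2i (k - k*) = -2i (k* - k)`. -/
theorem nSoliton_eq_superposition (κ : Fin N → ℂ) (β : Fin N → EuclideanSpace ℂ (Fin n))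
    (x t : ℝ) : nSoliton κ β x t = superposition κ fun j => seed (κ j) (β j) x t := by
  have h (P : Matrix (Fin n ⊕ Unit) (Fin n ⊕ Unit) ℂ) (a : Fin n) :
      (sigma3 n * P - P * sigma3 n) (Sum.inl a) (Sum.inr ()) =
        2 * P (Sum.inl a) (Sum.inr ()) := by
    simp [sigma3, Matrix.mul_apply, Fintype.sum_sum_type, Matrix.one_apply]
    ring
  ext a
  simp only [nSoliton, superposition, potential, residue, Matrix.sum_apply, Matrix.smul_apply, h,
    smul_eq_mul, Finset.mul_sum, zeta]
  exact Finset.sum_congr rfl fun j _ => by ring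

theorem superposition_smul (κ : Fin N → ℂ) {c : Fin N → ℂ} (hc : ∀ j, c j ≠ 0)
    (z : Fin N → Fin n ⊕ Unit → ℂ) :
    superposition κ (fun j => c j • z j) = superposition κ z := by
  simp only [superposition, residue, dressing_smul κ c hc, mulVec_smul, rankOneProj_smul (hc _)]

theorem seed_eq (κ : ℂ) (β : EuclideanSpace ℂ (Fin n)) (x t : ℝ) :
    seed κ β x t = Sum.elim (fun a => Complex.exp (-(Complex.I * phase x t (conj κ))) * β a)
      (fun _ => -Complex.exp (Complex.I * phase x t (conj κ))) := by
  ext (a | a) <;> simp [seed, expSigma3, mulVec_diagonal]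

theorem pole_im (u v : ℝ) : (pole u v).im = v / 2 := by
  simp [pole]

theorem pole_re (u v : ℝ) : (pole u v).re = u / 2 := by
  simp [pole]

theorem conj_pole (u v : ℝ) : conj (pole u v) = (u - Complex.I * v) / 2 := by
  simp [pole, map_ofNat, sub_eq_add_neg]

theorem conj_pole_sub_pole (u v : ℝ) : conj (pole u v) - pole u v = -(Complex.I * v) := by
  rw [conj_pole, pole]
  ring

theorem phase_conj_pole (u v x t : ℝ) : phase x t (conj (pole u v)) =
    (((u * x + (u ^ 2 - v ^ 2) * t) / 2 : ℝ) : ℂ) -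
      ((v * (x - velocity u * t) / 2 : ℝ) : ℂ) * Complex.I := by
  rw [conj_pole, phase, velocity]
  push_cast
  linear_combination (t * v ^ 2 / 2 : ℂ) * Complex.I_sq

/-- With `y = v (x - w t)`, the squared norm of the seed is `e^{-y} |γ|² + e^y = 2 |γ| cosh (y - ln
|γ|)`, which explains the shift `ln |γ| / v`. -/
theorem oneSoliton_apply {u v : ℝ} {γ : EuclideanSpace ℂ (Fin n)} (hγ : γ ≠ 0) (hv : v ≠ 0)
    (x t : ℝ) (a : Fin n) : oneSoliton u v γ x t a =
      -(2 * v) * rankOneProj (seed (pole u v) γ x t) (Sum.inl a) (Sum.inr ()) := by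
  have hr : 0 < ‖γ‖ := norm_pos_iff.2 hγ
  have hsum : ∑ b, conj (γ b) * γ b = ((‖γ‖ ^ 2 : ℝ) : ℂ) := by
    rw [EuclideanSpace.norm_sq_eq]
    push_cast
    exact Finset.sum_congr rfl fun b _ => by rw [mul_comm, Complex.mul_conj']
  obtain ⟨y, hy⟩ : ∃ y, y = v * (x - velocity u * t) := ⟨_, rfl⟩
  obtain ⟨θ, hθ⟩ : ∃ θ, θ = u * x + (u ^ 2 - v ^ 2) * t := ⟨_, rfl⟩
  have hcosh : Real.cosh (v * (x - velocity u * t - position v γ)) =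
      (Real.exp y * ‖γ‖⁻¹ + Real.exp (-y) * ‖γ‖) / 2 := by
    have : v * (x - velocity u * t - position v γ) = y - Real.log ‖γ‖ := by
      rw [position, hy]; field_simp
    rw [this, Real.cosh_eq, neg_sub, sub_eq_add_neg, Real.exp_add, Real.exp_neg (Real.log _),
      Real.exp_log hr, sub_eq_add_neg, Real.exp_add, Real.exp_log hr]
    ring
  have hφ : phase x t (conj (pole u v)) = ((θ / 2 : ℝ) : ℂ) - ((y / 2 : ℝ) : ℂ) * Complex.I := by
    rw [phase_conj_pole, hθ, hy]
  have hI := Complex.I_sq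
  have h11 : conj (Complex.exp (-(Complex.I * phase x t (conj (pole u v))))) *
      Complex.exp (-(Complex.I * phase x t (conj (pole u v)))) = (Real.exp (-y) : ℂ) := by
    rw [← Complex.exp_conj, ← Complex.exp_add, Complex.ofReal_exp, hφ]
    congr 1
    simp only [map_neg, map_mul, map_sub, Complex.conj_I, Complex.conj_ofReal]
    push_cast
    linear_combination (y : ℂ) * hI
  have h22 : conj (Complex.exp (Complex.I * phase x t (conj (pole u v)))) *
      Complex.exp (Complex.I * phase x t (conj (pole u v))) = (Real.exp y : ℂ) := by
    rw [← Complex.exp_conj, ← Complex.exp_add, Complex.ofReal_exp, hφ]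
    congr 1
    simp only [map_mul, map_sub, Complex.conj_I, Complex.conj_ofReal]
    push_cast
    linear_combination -(y : ℂ) * hI
  have h12 : Complex.exp (-(Complex.I * phase x t (conj (pole u v)))) *
      conj (Complex.exp (Complex.I * phase x t (conj (pole u v)))) =
        Complex.exp (-(Complex.I * θ)) := by
    rw [← Complex.exp_conj, ← Complex.exp_add, hφ]
    congr 1
    simp only [map_mul, map_sub, Complex.conj_I, Complex.conj_ofReal]
    push_cast
    ring
  have hden : star (seed (pole u v) γ x t) ⬝ᵥ seed (pole u v) γ x t =
      ((Real.exp (-y) * ‖γ‖ ^ 2 + Real.exp y : ℝ) : ℂ) := by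
    rw [Complex.ofReal_add, Complex.ofReal_mul, ← h11, ← h22, ← hsum, seed_eq, Finset.mul_sum]
    simp only [dotProduct, Fintype.sum_sum_type, Pi.star_apply, RCLike.star_def, Sum.elim_inl,
      Sum.elim_inr, Finset.univ_unique, Finset.sum_singleton, map_mul, map_neg, neg_mul_neg]
    congr 1
    exact Finset.sum_congr rfl fun b _ => by ring
  have hnum : seed (pole u v) γ x t (Sum.inl a) * conj (seed (pole u v) γ x t (Sum.inr ())) =
      -(Complex.exp (-(Complex.I * θ)) * γ a) := by
    rw [← h12, seed_eq, Sum.elim_inl, Sum.elim_inr, map_neg]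
    ring
  simp only [rankOneProj, Matrix.smul_apply, vecMulVec_apply, Pi.star_apply, RCLike.star_def, hnum,
    hden, oneSoliton, polarization, hcosh, ← hθ, PiLp.smul_apply, smul_eq_mul]
  have h1 : ((Real.exp (-y) * ‖γ‖ ^ 2 + Real.exp y : ℝ) : ℂ) ≠ 0 := by
    exact_mod_cast (by positivity : (0:ℝ) < Real.exp (-y) * ‖γ‖ ^ 2 + Real.exp y).ne'
  have h2 : (((Real.exp y * ‖γ‖⁻¹ + Real.exp (-y) * ‖γ‖) / 2 : ℝ) : ℂ) =
     ((Real.exp (-y) * ‖γ‖ ^ 2 + Real.exp y : ℝ) : ℂ) / (2 * ‖γ‖) := by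
    have : (‖γ‖ : ℂ) ≠ 0 := by exact_mod_cast hr.ne'
    push_cast
    field_simp
    ring
  have : (‖γ‖ : ℂ) ≠ 0 := by exact_mod_cast hr.ne'
  rw [h2]
  field_simp

/-- The norming constant of the soliton `l` on the background selected by `p`. -/
noncomputable def dressedNorming (κ : Fin N → ℂ) (β : Fin N → EuclideanSpace ℂ (Fin n))
    (p : Fin N → Bool) (l : Fin N) : EuclideanSpace ℂ (Fin n) :=
  WithLp.toLp 2
    (((((List.finRange N).filter (· ≠ l)).filter fun i => !p i).map fun m =>
        blaschke (κ m) (conj (κ l))).prod •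
      ((reducedDressing κ β (((List.finRange N).filter (· ≠ l)).filter fun i => p i) (κ l))ᴴ *ᵥ
        fun a => β l a))

theorem dressedNorming_ne_zero {κ : Fin N → ℂ} (hκ : ∀ j, 0 < (κ j).im)
    (hinj : Function.Injective κ) {β : Fin N → EuclideanSpace ℂ (Fin n)} (hβ : ∀ j, β j ≠ 0)
    (p : Fin N → Bool) (l : Fin N) : dressedNorming κ β p l ≠ 0 := by
  rw [dressedNorming, ne_eq, WithLp.toLp_eq_zero]
  refine smul_ne_zero (List.prod_ne_zero ?_) (conjTranspose_mulVec_ne_zero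
    (isUnit_dressing hκ _ (hκ l) fun i hi h => ?_) fun h => hβ l (by ext a; exact congrFun h a))
  · simp only [List.mem_map, List.mem_filter, not_exists, not_and]
    intro i hi h
    have h1 := blaschke_ne_zero (hκ i) (hκ l) (fun h' => by
      have := hinj h'; simp [this] at hi)
    -- `f_i(κ_l*)` is the inverse of the conjugate of `f_i(κ_l)`; its vanishing would give `0⁻¹ ≠
    -- 0`, against the convention `0⁻¹ = 0`.
    rw [← map_ne_zero (starRingEnd ℂ), conj_blaschke, h] at h1
    simp at h1
  · have := hinj h
    simp [this] at hi

/-- The frozen background acts on the seed `l` through `diag (d†, P*)`. Up to the scalar `P*` the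
result is a seed with norming constant `(P*)⁻¹ d† β_l`, and the scalar does not affect the
projector. -/
theorem superposition_eq_oneSoliton {u v : Fin N → ℝ} (hv : ∀ j, 0 < v j)
    (hu : Function.Injective u) {β : Fin N → EuclideanSpace ℂ (Fin n)} (hβ : ∀ j, β j ≠ 0)
    (p : Fin N → Bool) (l : Fin N) (x t : ℝ) :
    superposition (fun j => pole (u j) (v j)) (Function.update (background p fun j a => β j a) l
        (seed (pole (u l) (v l)) (β l) x t)) =
      oneSoliton (u l) (v l) (dressedNorming (fun j => pole (u j) (v j)) β p l) x t := by
  obtain ⟨κ, hκdef⟩ : ∃ κ : Fin N → ℂ, κ = fun j => pole (u j) (v j) := ⟨_, rfl⟩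
  have hκ : ∀ j, 0 < (κ j).im := fun j => by
    rw [hκdef, pole_im]; exact half_pos (hv j)
  have hinj : Function.Injective κ := fun i j h => hu <| by
    have := congrArg Complex.re h
    simp only [hκdef, pole_re] at this
    linarith
  rw [← hκdef]
  have hl : pole (u l) (v l) = κ l := by rw [hκdef]
  ext a
  rw [superposition, oneSoliton_apply (dressedNorming_ne_zero hκ hinj hβ p l) (hv l).ne',
    PiLp.toLp_apply, residue_of_eq_background hκ hinj (p := p) (β := fun j a => β j a) (l := l)
      (fun m hm => Function.update_of_ne hm _ _), Function.update_self,
    dressing_background hκ hinj _ _ ((List.nodup_finRange N).filter _), hl]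
  obtain ⟨P, hP⟩ : ∃ P, P = ((((List.finRange N).filter (· ≠ l)).filter fun i => !p i).map fun m =>
        blaschke (κ m) (κ l)).prod := ⟨_, rfl⟩
  have hPl : ((((List.finRange N).filter (· ≠ l)).filter fun i => !p i).map fun m =>
        blaschke (κ m) (conj (κ l))).prod = (conj P)⁻¹ := by
    rw [hP, map_list_prod, List.prod_inv, List.map_map, List.map_map]
    congr 1
    refine List.map_congr_left fun m _ => ?_
    simp only [Function.comp_apply, conj_blaschke, inv_inv]
  have hP0 : conj P ≠ 0 := by
    rw [map_ne_zero, hP]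
    refine List.prod_ne_zero ?_
    simp only [List.mem_map, List.mem_filter, not_exists, not_and]
    intro i hi
    exact blaschke_ne_zero (hκ i) (hκ l) fun h => by
      have := hinj h
      simp [this] at hi
  have hζ : (fromBlocks (dressing κ (fun j a => β j a)
        (((List.finRange N).filter (· ≠ l)).filter fun i => p i) (κ l)) 0 0
        (P • (1 : Matrix Unit Unit ℂ)))ᴴ *ᵥ seed (κ l) (β l) x t =
      conj P • seed (κ l) (dressedNorming κ β p l) x t := by
    rw [seed_eq, seed_eq, dressedNorming, hPl, fromBlocks_conjTranspose, fromBlocks_mulVec]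
    ext (b | b)
    · have h1 : (fun a => Complex.exp (-(Complex.I * phase x t (conj (κ l)))) * β l a) =
          Complex.exp (-(Complex.I * phase x t (conj (κ l)))) • fun a => β l a := rfl
      simp [h1, mulVec_smul, reducedDressing]
      field_simp
    · simp [conjTranspose_smul, smul_mulVec]
  rw [← hP, hζ, rankOneProj_smul hP0, ← hl, conj_pole_sub_pole]
  linear_combination (2 * v l * rankOneProj (seed (pole (u l) (v l)) (dressedNorming κ β p l) x t)
    (Sum.inl a) (Sum.inr ())) * Complex.I_sq

end Soliton

/-! ### Second order estimates for `C²` maps. -/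

section Estimate

variable {E G : Type*} [NormedAddCommGroup E] [NormedSpace ℝ E] [FiniteDimensional ℝ E]
  [NormedAddCommGroup G] [NormedSpace ℝ G]

theorem exists_lipschitzOnWith_closedBall {F : E → G} (hF : ContDiff ℝ 1 F) (R : ℝ) :
    ∃ K, LipschitzOnWith K F (Metric.closedBall 0 R) :=
  hF.contDiffOn.exists_lipschitzOnWith one_ne_zero (convex_closedBall 0 R)
    (isCompact_closedBall 0 R)

/-- A `C²` function has second mixed differences of second order. -/
theorem exists_norm_mixed_difference_le {F : E → G} (hF : ContDiff ℝ 2 F) :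
    ∃ M : ℝ, 0 ≤ M ∧ ∀ a b : E, ‖a‖ ≤ 1 → ‖b‖ ≤ 1 →
      ‖F (a + b) - F a - F b + F 0‖ ≤ M * (‖a‖ * ‖b‖) := by
  have hF' : ContDiff ℝ 1 (fderiv ℝ F) := hF.fderiv_right (by norm_num)
  -- Radius `2` accommodates `x + b` with both summands in the unit ball.
  obtain ⟨K, hK⟩ := exists_lipschitzOnWith_closedBall hF' 2
  have hd : Differentiable ℝ F := hF.differentiable (by norm_num)
  refine ⟨K, K.2, fun a b ha hb => ?_⟩
  -- Mean value inequality for `x ↦ F (x + b) - F x`, whose derivative is at most `K ‖b‖` by the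
  -- Lipschitz bound on `F'`.
  have key := (convex_closedBall (0 : E) 1).norm_image_sub_le_of_norm_hasFDerivWithin_le
    (f := fun x => F (x + b) - F x) (f' := fun x => fderiv ℝ F (x + b) - fderiv ℝ F x)
    (C := K * ‖b‖) (x := 0) (y := a) (fun x _ => by
      have h1 : HasFDerivAt (fun x => F (x + b)) (fderiv ℝ F (x + b)) x :=
        (hasFDerivAt_comp_add_right b).2 (hd (x + b)).hasFDerivAt
      exact (h1.sub (hd x).hasFDerivAt).hasFDerivWithinAt)
    (fun x hx => by
      have hx' : ‖x‖ ≤ 1 := by simpa using hx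
      have := hK.norm_sub_le (x := x + b) (y := x)
        (by simpa using (norm_add_le x b).trans (by linarith)) (by simpa using hx'.trans one_le_two)
      simpa using this)
    (by simp) (by simpa using ha)
  have e : F (a + b) - F a - F b + F 0 = F (a + b) - F a - (F (0 + b) - F 0) := by
    rw [zero_add]; abel
  rw [e]
  refine key.trans_eq ?_
  rw [sub_zero]
  ring

/-- Coordinates are switched on one at a time; each step costs one mixed difference between the new
coordinate and those already present. -/
theorem exists_norm_sub_sum_single_le {N : ℕ} {F : (Fin N → ℂ) → G} (hF : ContDiff ℝ 2 F)
    (h0 : F 0 = 0) : ∃ C : ℝ, 0 ≤ C ∧ ∀ (c : Fin N → ℂ) (δ : ℝ), 0 ≤ δ → (∀ j, ‖c j‖ ≤ 1) →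
      (∀ i j, i ≠ j → ‖c i‖ * ‖c j‖ ≤ δ) → ‖F c - ∑ j, F (Pi.single j (c j))‖ ≤ C * δ := by
  obtain ⟨M, hM, hFM⟩ := exists_norm_mixed_difference_le hF
  refine ⟨N * M, by positivity, fun c δ hδ hc hcc => ?_⟩
  have key : ∀ s : Finset (Fin N),
      ‖F (fun j => if j ∈ s then c j else 0) - ∑ j ∈ s, F (Pi.single j (c j))‖ ≤
        s.card * (M * δ) := by
    intro s
    induction s using Finset.induction_on with
    | empty =>
      have : (fun _ => 0 : Fin N → ℂ) = 0 := rfl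
      simp [this, h0]
    | insert i s hi ih =>
      have e : (fun j => if j ∈ insert i s then c j else 0) =
          (fun j => if j ∈ s then c j else 0) + Pi.single i (c i) := by
        ext j
        by_cases hj : j = i
        · subst hj; simp [hi]
        · simp [hj]
      rw [e, Finset.sum_insert hi, Finset.card_insert_of_notMem hi]
      set b : Fin N → ℂ := fun j => if j ∈ s then c j else 0
      have hb : ‖b‖ ≤ 1 := (pi_norm_le_iff_of_nonneg zero_le_one).2 fun j => by
        by_cases hj : j ∈ s <;> simp [b, hj, hc j]
      have hi1 : ‖(Pi.single i (c i) : Fin N → ℂ)‖ = ‖c i‖ := Pi.norm_single _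
      have hprod : ‖b‖ * ‖(Pi.single i (c i) : Fin N → ℂ)‖ ≤ δ := by
        -- Written as the sup norm of `‖c i‖ • b`, the product can be bounded coordinatewise by the
        -- pairwise hypothesis.
        rw [hi1, mul_comm, ← Real.norm_of_nonneg (norm_nonneg (c i)), ← norm_smul]
        refine (pi_norm_le_iff_of_nonneg hδ).2 fun j => ?_
        by_cases hj : j ∈ s
        · have := hcc i j (by rintro rfl; exact hi hj)
          simpa [b, hj] using this
        · simpa [b, hj] using hδ
      have h1 := (hFM b (Pi.single i (c i)) hb (hi1.trans_le (hc i))).trans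
        (mul_le_mul_of_nonneg_left hprod hM)
      rw [h0, add_zero] at h1
      calc ‖F (b + Pi.single i (c i)) - (F (Pi.single i (c i)) + ∑ j ∈ s, F (Pi.single j (c j)))‖
          = ‖(F (b + Pi.single i (c i)) - F b - F (Pi.single i (c i))) +
              (F b - ∑ j ∈ s, F (Pi.single j (c j)))‖ := by congr 1; abel
        _ ≤ M * δ + s.card * (M * δ) := (norm_add_le _ _).trans (add_le_add h1 ih)
        _ = _ := by push_cast; ring
  have := key Finset.univ
  simpa [mul_assoc] using this

theorem exists_norm_le_mul_norm {F : E → G} (hF : ContDiff ℝ 2 F) (h0 : F 0 = 0) :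
    ∃ C : ℝ, 0 ≤ C ∧ ∀ c, ‖c‖ ≤ 1 → ‖F c‖ ≤ C * ‖c‖ := by
  obtain ⟨K, hK⟩ := exists_lipschitzOnWith_closedBall (hF.of_le (by norm_num)) 1
  refine ⟨K, K.2, fun c hc => ?_⟩
  simpa [h0] using hK.norm_sub_le (x := c) (y := 0) (by simpa using hc) (by simp)

end Estimate

/-! ### Smooth dependence on the vectors. -/

section Smooth

variable {E ι : Type*} [NormedAddCommGroup E] [NormedSpace ℝ E] [Fintype ι]

theorem contDiff_conj {f : E → ℂ} (hf : ContDiff ℝ 2 f) : ContDiff ℝ 2 fun c => conj (f c) :=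
  Complex.conjCLE.contDiff.comp hf

theorem contDiff_rankOneProj {ζ : E → ι → ℂ} (h : ∀ a, ContDiff ℝ 2 fun c => ζ c a)
    (h0 : ∀ c, ζ c ≠ 0) (a b : ι) : ContDiff ℝ 2 fun c => rankOneProj (ζ c) a b := by
  simp only [rankOneProj, Matrix.smul_apply, vecMulVec_apply, Pi.star_apply, RCLike.star_def,
    smul_eq_mul]
  refine ContDiff.mul (ContDiff.inv ?_ fun c => dotProduct_star_self_ne_zero (h0 c))
    ((h a).mul (contDiff_conj (h b)))
  simp only [dotProduct, Pi.star_apply, RCLike.star_def]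
  exact ContDiff.sum fun i _ => (contDiff_conj (h i)).mul (h i)

theorem contDiff_conjTranspose_mulVec {D : E → Matrix ι ι ℂ} {z : E → ι → ℂ}
    (hD : ∀ a b, ContDiff ℝ 2 fun c => D c a b) (hz : ∀ a, ContDiff ℝ 2 fun c => z c a) (a : ι) :
    ContDiff ℝ 2 fun c => ((D c)ᴴ *ᵥ z c) a := by
  simp only [mulVec, dotProduct, conjTranspose_apply, RCLike.star_def]
  exact ContDiff.sum fun i _ => (contDiff_conj (hD i a)).mul (hz i)

variable [DecidableEq ι]

/-- The only denominators are squared norms of dressed vectors, nonzero because the preceding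
factors are invertible at a new pole. Smoothness is over `ℝ`, as conjugation is not holomorphic. -/
theorem contDiff_dressing {J : Type*} {κ : J → ℂ} (hκ : ∀ j, 0 < (κ j).im)
    (hinj : Function.Injective κ) {z : E → J → ι → ℂ}
    (hz : ∀ j a, ContDiff ℝ 2 fun c => z c j a) (h0 : ∀ c j, z c j ≠ 0) {l : List J}
    (hl : l.Nodup) (k : ℂ) (a b : ι) : ContDiff ℝ 2 fun c => dressing κ (z c) l k a b := by
  induction l using List.reverseRecOn generalizing k a b with
  | nil => simpa using contDiff_const
  | append_singleton l j ih =>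
    have hl' := List.nodup_append.1 hl
    have ih' := ih hl'.1
    simp only [dressing_concat, Matrix.mul_apply, dressingFactor, Matrix.add_apply,
      Matrix.smul_apply, smul_eq_mul]
    refine ContDiff.sum fun i _ => (ih' k a i).mul (contDiff_const.add (contDiff_const.mul ?_))
    refine contDiff_rankOneProj (fun a => contDiff_conjTranspose_mulVec (ih' _) (hz j) a)
      (fun c => conjTranspose_mulVec_ne_zero (isUnit_dressing hκ _ (hκ j) fun m hm h => ?_)
        (h0 c j)) i b
    exact hl'.2.2 m hm j (by simp) (hinj h).symm

theorem contDiff_superposition {n N : ℕ} {κ : Fin N → ℂ} (hκ : ∀ j, 0 < (κ j).im)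
    (hinj : Function.Injective κ) {z : E → Fin N → Fin n ⊕ Unit → ℂ}
    (hz : ∀ j a, ContDiff ℝ 2 fun c => z c j a) (h0 : ∀ c j, z c j ≠ 0) :
    ContDiff ℝ 2 fun c => superposition κ (z c) := by
  rw [contDiff_piLp]
  intro a
  simp only [superposition, residue, Matrix.sum_apply, Matrix.smul_apply, smul_eq_mul]
  refine contDiff_const.mul (ContDiff.sum fun j _ => contDiff_const.mul ?_)
  refine contDiff_rankOneProj (fun a => contDiff_conjTranspose_mulVec
    (contDiff_dressing hκ hinj hz h0 ((List.nodup_finRange N).filter _) _) (hz j) a)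
    (fun c => conjTranspose_mulVec_ne_zero (isUnit_dressing hκ _ (hκ j) fun m hm h => ?_)
      (h0 c j)) _ _
  have := hinj h
  simp [this] at hm

end Smooth

/-! ### Charts, background comparison and asymptotic norming constants. -/

section Asymptotics

variable {n N : ℕ}

/-- Representatives of the lines spanned by the seeds, normalized in the block selected by `p`. -/
noncomputable def chart (p : Fin N → Bool) (β : Fin N → EuclideanSpace ℂ (Fin n)) (c : Fin N → ℂ)
    (j : Fin N) : Fin n ⊕ Unit → ℂ :=
  if p j then Sum.elim (fun a => β j a) (fun _ => c j)
  else Sum.elim (fun a => c j * β j a) (fun _ => -1)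

theorem chart_zero (p : Fin N → Bool) (β : Fin N → EuclideanSpace ℂ (Fin n)) :
    chart p β 0 = background p fun j a => β j a := by
  ext j (a | a) <;> by_cases h : p j <;> simp [chart, background, h]

theorem chart_single (p : Fin N → Bool) (β : Fin N → EuclideanSpace ℂ (Fin n)) (l : Fin N)
    (c : Fin N → ℂ) : chart p β (Pi.single l (c l)) =
      Function.update (background p fun j a => β j a) l (chart p β c l) := by
  ext j (a | a) <;> by_cases hj : j = l
  · subst hj; simp [chart]
  · by_cases h : p j <;> simp [chart, background, h, hj]
  · subst hj; simp [chart]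
  · by_cases h : p j <;> simp [chart, background, h, hj]

theorem chart_ne_zero (p : Fin N → Bool) {β : Fin N → EuclideanSpace ℂ (Fin n)}
    (hβ : ∀ j, β j ≠ 0) (c : Fin N → ℂ) (j : Fin N) : chart p β c j ≠ 0 := by
  intro h0
  by_cases h : p j
  · refine hβ j ?_
    ext a
    simpa [chart, h] using congrFun h0 (Sum.inl a)
  · simpa [chart, h] using congrFun h0 (Sum.inr ())

theorem contDiff_chart (p : Fin N → Bool) (β : Fin N → EuclideanSpace ℂ (Fin n)) (j : Fin N)
    (a : Fin n ⊕ Unit) : ContDiff ℝ 2 fun c => chart p β c j a := by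
  by_cases h : p j <;> rcases a with a | a <;> simp only [chart, h, if_true, Sum.elim_inl,
    Sum.elim_inr, Bool.false_eq_true, if_false]
  · exact contDiff_const
  · exact contDiff_apply ℝ ℂ j
  · exact (contDiff_apply ℝ ℂ j).mul contDiff_const
  · exact contDiff_const

/-- The coordinate of a seed in the charts with `p j = b`. -/
noncomputable def seedCoord (b : Bool) (κ : ℂ) (x t : ℝ) : ℂ :=
  if b then -Complex.exp (2 * (Complex.I * phase x t (conj κ)))
  else Complex.exp (-(2 * (Complex.I * phase x t (conj κ))))

/-- The factor relating a seed to its representative in the charts with `p j = b`. -/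
noncomputable def seedScale (b : Bool) (κ : ℂ) (x t : ℝ) : ℂ :=
  if b then Complex.exp (-(Complex.I * phase x t (conj κ)))
  else Complex.exp (Complex.I * phase x t (conj κ))

theorem seedScale_ne_zero (b : Bool) (κ : ℂ) (x t : ℝ) : seedScale b κ x t ≠ 0 := by
  cases b <;> simp [seedScale]

theorem seed_eq_smul_chart (p : Fin N → Bool) (κ : Fin N → ℂ)
    (β : Fin N → EuclideanSpace ℂ (Fin n)) (x t : ℝ) (j : Fin N) :
    seed (κ j) (β j) x t = seedScale (p j) (κ j) x t •
      chart p β (fun i => seedCoord (p i) (κ i) x t) j := by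
  rw [seed_eq]
  ext (a | a) <;> by_cases h : p j
  · simp [chart, h, seedScale]
  · simp only [chart, h, seedScale, seedCoord, Sum.elim_inl, Bool.false_eq_true, if_false,
      Pi.smul_apply, smul_eq_mul, ← mul_assoc, ← Complex.exp_add]
    ring_nf
  · simp only [chart, h, seedScale, seedCoord, Sum.elim_inr, if_true,
      Pi.smul_apply, smul_eq_mul, mul_neg, ← Complex.exp_add]
    ring_nf
  · simp [chart, h, seedScale]

theorem phase_conj_pole_im (u v x t : ℝ) :
    (phase x t (conj (pole u v))).im = -(v * (x - velocity u * t) / 2) := by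
  rw [phase_conj_pole, Complex.sub_im, Complex.ofReal_im, Complex.mul_I_im, Complex.ofReal_re,
    zero_sub]

/-- Choosing the chart by the side of the soliton on which `x` lies fixes the sign of the exponent,
so the coordinate never leaves the unit disc and decays away from the soliton. -/
theorem norm_seedCoord (u v x t : ℝ) :
    ‖seedCoord (decide (x ≤ velocity u * t)) (pole u v) x t‖ =
      Real.exp (-(v * |x - velocity u * t|)) := by
  by_cases h : x ≤ velocity u * t
  · rw [abs_of_nonpos (by linarith)]
    simp only [seedCoord, h, decide_true, if_true, norm_neg, Complex.norm_exp]
    congr 1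
    simp [phase_conj_pole_im]
    ring
  · rw [abs_of_pos (by linarith)]
    simp only [seedCoord, h, decide_false, if_false, Bool.false_eq_true, Complex.norm_exp]
    congr 1
    simp [phase_conj_pole_im]
    ring

theorem dressedNorming_congr (κ : Fin N → ℂ) (β : Fin N → EuclideanSpace ℂ (Fin n))
    {p p' : Fin N → Bool} {l : Fin N} (h : ∀ m, m ≠ l → p m = p' m) :
    dressedNorming κ β p l = dressedNorming κ β p' l := by
  have h1 : (((List.finRange N).filter (· ≠ l)).filter fun i => p i) =
      ((List.finRange N).filter (· ≠ l)).filter fun i => p' i :=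
    List.filter_congr fun m hm => h m (by simpa using hm)
  have h2 : (((List.finRange N).filter (· ≠ l)).filter fun i => !p i) =
      ((List.finRange N).filter (· ≠ l)).filter fun i => !p' i :=
    List.filter_congr fun m hm => by rw [h m (by simpa using hm)]
  rw [dressedNorming, dressedNorming, h1, h2]

variable {u v : Fin N → ℝ} {β : Fin N → EuclideanSpace ℂ (Fin n)}

theorem superposition_chart_single (hv : ∀ j, 0 < v j) (hu : Function.Injective u)
    (hβ : ∀ j, β j ≠ 0) (p : Fin N → Bool) (l : Fin N) (x t : ℝ) :
    superposition (fun j => pole (u j) (v j))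
        (chart p β (Pi.single l (seedCoord (p l) (pole (u l) (v l)) x t))) =
      oneSoliton (u l) (v l) (dressedNorming (fun j => pole (u j) (v j)) β p l) x t := by
  rw [← superposition_eq_oneSoliton hv hu hβ,
    chart_single p β l (fun i => seedCoord (p i) (pole (u i) (v i)) x t)]
  rw [seed_eq_smul_chart p (fun j => pole (u j) (v j)) β x t l]
  -- Only the vector `l` is rescaled, from its chart representative to the seed.
  rw [← superposition_smul _ (c := Function.update 1 l (seedScale (p l) (pole (u l) (v l)) x t))]
  · congr 1
    funext j
    by_cases hj : j = l
    · subst hj; simp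
    · simp [hj]
  · intro j
    by_cases hj : j = l
    · subst hj; simp [seedScale_ne_zero]
    · simp [hj]

theorem minAmplitude_nonneg (hv : ∀ j, 0 < v j) : 0 ≤ minAmplitude v :=
  Real.iInf_nonneg fun j => (hv j).le

theorem minAmplitude_le (v : Fin N → ℝ) (j : Fin N) : minAmplitude v ≤ v j :=
  ciInf_le (Set.finite_range v).bddBelow j

theorem minRelativeSpeed_le (u : Fin N → ℝ) {i j : Fin N} (h : i ≠ j) :
    minRelativeSpeed u ≤ |velocity (u i) - velocity (u j)| :=
  ciInf_le (f := fun p : {p : Fin N × Fin N // p.1 ≠ p.2} =>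
    |velocity (u p.1.1) - velocity (u p.1.2)|) (Set.finite_range _).bddBelow ⟨(i, j), h⟩

/-- Comparison of the `N`-soliton with a sum of solitons on prescribed backgrounds: the backgrounds
`bg l` have to be the actual ones except for solitons far away from `x`. -/
theorem exists_norm_nSoliton_sub_le (hv : ∀ j, 0 < v j) (hu : Function.Injective u)
    (hβ : ∀ j, β j ≠ 0) (bg : Fin N → Fin N → Bool) :
    ∃ C : ℝ, ∀ x t : ℝ,
      (∀ l m, m ≠ l → decide (x ≤ velocity (u m) * t) ≠ bg l m →
        minRelativeSpeed u * |t| ≤ |x - velocity (u l) * t|) →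
      ‖nSoliton (fun j => pole (u j) (v j)) β x t - ∑ l, oneSoliton (u l) (v l)
        (dressedNorming (fun j => pole (u j) (v j)) β (bg l) l) x t‖ ≤
        C * Real.exp (-(minAmplitude v * minRelativeSpeed u * |t|)) := by
  obtain ⟨κ, hκdef⟩ : ∃ κ : Fin N → ℂ, κ = fun j => pole (u j) (v j) := ⟨_, rfl⟩
  have hκ : ∀ j, 0 < (κ j).im := fun j => by
    rw [hκdef, pole_im]; exact half_pos (hv j)
  have hinj : Function.Injective κ := fun i j h => hu <| by
    have := congrArg Complex.re h
    simp only [hκdef, pole_re] at this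
    linarith
  have hF (p : Fin N → Bool) : ContDiff ℝ 2 fun c => superposition κ (chart p β c) :=
    contDiff_superposition hκ hinj (contDiff_chart p β) (chart_ne_zero p hβ)
  have hF0 (p : Fin N → Bool) : superposition κ (chart p β 0) = 0 := by
    ext a
    simp [superposition, chart_zero, residue_background hκ hinj]
  choose C₁ hC₁ hC₁' using fun p => exists_norm_sub_sum_single_le (hF p) (hF0 p)
  choose C₂ hC₂ hC₂' using fun p => exists_norm_le_mul_norm (hF p) (hF0 p)
  -- The chart depends on `x` and `t`. Summing over all `2 ^ N` charts makes the constants uniform.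
  have hK (p : Fin N → Bool) : C₁ p ≤ ∑ p, C₁ p :=
    Finset.single_le_sum (fun q _ => hC₁ q) (Finset.mem_univ p)
  have hL (p : Fin N → Bool) : C₂ p ≤ ∑ p, C₂ p :=
    Finset.single_le_sum (fun q _ => hC₂ q) (Finset.mem_univ p)
  have hL0 : 0 ≤ ∑ p, C₂ p := Finset.sum_nonneg fun q _ => hC₂ q
  refine ⟨∑ p, C₁ p + N * (2 * ∑ p, C₂ p), fun x t hbg => ?_⟩
  obtain ⟨p, hp⟩ : ∃ p : Fin N → Bool, p = fun j => decide (x ≤ velocity (u j) * t) := ⟨_, rfl⟩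
  obtain ⟨c, hc⟩ : ∃ c : Fin N → ℂ, c = fun j => seedCoord (p j) (κ j) x t := ⟨_, rfl⟩
  obtain ⟨δ, hδ⟩ : ∃ δ, δ = Real.exp (-(minAmplitude v * minRelativeSpeed u * |t|)) := ⟨_, rfl⟩
  have hδ0 : 0 ≤ δ := hδ ▸ (Real.exp_pos _).le
  have hcn (j : Fin N) : ‖c j‖ = Real.exp (-(v j * |x - velocity (u j) * t|)) := by
    rw [hc, ← norm_seedCoord (u j) (v j), hp, hκdef]
  have hc1 (j : Fin N) : ‖c j‖ ≤ 1 := by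
    rw [hcn, Real.exp_le_one_iff, neg_nonpos]
    exact mul_nonneg (hv j).le (abs_nonneg _)
  have hcc (i j : Fin N) (hij : i ≠ j) : ‖c i‖ * ‖c j‖ ≤ δ := by
    rw [hcn, hcn, hδ, ← Real.exp_add, Real.exp_le_exp]
    have h1 := mul_le_mul_of_nonneg_right (minAmplitude_le v i)
      (abs_nonneg (x - velocity (u i) * t))
    have h2 := mul_le_mul_of_nonneg_right (minAmplitude_le v j)
      (abs_nonneg (x - velocity (u j) * t))
    have h3 : minRelativeSpeed u * |t| ≤
        |x - velocity (u i) * t| + |x - velocity (u j) * t| := by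
      refine (mul_le_mul_of_nonneg_right (minRelativeSpeed_le u hij.symm) (abs_nonneg t)).trans ?_
      rw [← abs_mul]
      -- The points `w_i t` and `w_j t` are at least `w̃ |t|` apart, so the distances from `x` to
      -- them add up to at least that.
      refine le_trans (le_of_eq ?_) (abs_sub _ _)
      congr 1
      ring
    have h4 := mul_le_mul_of_nonneg_left h3 (minAmplitude_nonneg hv)
    linarith
  have hR : nSoliton κ β x t = superposition κ (chart p β c) := by
    rw [nSoliton_eq_superposition,
      ← superposition_smul κ (fun j => seedScale_ne_zero (p j) (κ j) x t) (chart p β c)]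
    congr 1
    funext j
    rw [seed_eq_smul_chart p κ β x t j, hc]
  have hmain := (hC₁' p c δ hδ0 hc1 hcc).trans (mul_le_mul_of_nonneg_right (hK p) hδ0)
  have hone (l : Fin N) : ‖superposition κ (chart p β (Pi.single l (c l))) -
      oneSoliton (u l) (v l) (dressedNorming κ β (bg l) l) x t‖ ≤ 2 * (∑ p, C₂ p) * δ := by
    have hp' (q : Fin N → Bool) (hq : q l = p l) :
        superposition κ (chart q β (Pi.single l (c l))) =
          oneSoliton (u l) (v l) (dressedNorming κ β q l) x t := by
      rw [hκdef, ← superposition_chart_single hv hu hβ, hc, hq, hκdef]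
    by_cases h : ∀ m, m ≠ l → p m = bg l m
    · rw [hp' p rfl, dressedNorming_congr κ β h, sub_self, norm_zero]
      positivity
    · push Not at h
      obtain ⟨m, hm, hne⟩ := h
      have hfar := hbg l m hm (by rwa [hp] at hne)
      have hcδ : ‖(Pi.single l (c l) : Fin N → ℂ)‖ ≤ δ := by
        rw [Pi.norm_single, hcn, hδ, Real.exp_le_exp, neg_le_neg_iff, mul_assoc]
        exact (mul_le_mul_of_nonneg_left hfar (minAmplitude_nonneg hv)).trans
          (mul_le_mul_of_nonneg_right (minAmplitude_le v l) (abs_nonneg _))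
      have hbound (q : Fin N → Bool) :
          ‖superposition κ (chart q β (Pi.single l (c l)))‖ ≤ (∑ p, C₂ p) * δ :=
        (hC₂' q _ ((Pi.norm_single _).trans_le (hc1 l))).trans
          (mul_le_mul (hL q) hcδ (norm_nonneg _) hL0)
      -- The norming constant ignores the value of the background at `l`. Resetting it to `p l` lets
      -- the expected soliton be evaluated at the same small coordinate `c l`, so both terms are
      -- `O(δ)`.
      rw [← dressedNorming_congr κ β (p := Function.update (bg l) l (p l)) (l := l)
        (fun m hm => Function.update_of_ne hm _ _), ← hp' _ (Function.update_self ..)]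
      refine (norm_sub_le _ _).trans ((add_le_add (hbound _) (hbound _)).trans_eq ?_)
      ring
  rw [← hκdef, ← hδ, hR]
  calc ‖superposition κ (chart p β c) -
        ∑ l, oneSoliton (u l) (v l) (dressedNorming κ β (bg l) l) x t‖
      = ‖(superposition κ (chart p β c) - ∑ l, superposition κ (chart p β (Pi.single l (c l)))) +
          ∑ l, (superposition κ (chart p β (Pi.single l (c l))) -
            oneSoliton (u l) (v l) (dressedNorming κ β (bg l) l) x t)‖ := by
        rw [Finset.sum_sub_distrib]; congr 1; abel
    _ ≤ (∑ p, C₁ p) * δ + ∑ _l : Fin N, 2 * (∑ p, C₂ p) * δ :=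
        (norm_add_le _ _).trans (add_le_add hmain
          ((norm_sum_le _ _).trans (Finset.sum_le_sum fun l _ => hone l)))
    _ = _ := by
        rw [Finset.sum_const, Finset.card_univ, Fintype.card_fin, nsmul_eq_mul]
        ring

/-- This is the background for `t > 0`: near `x = w_l t` one has `x < w_m t` exactly when `w_m >
w_l`, that is `m < l`. For `t < 0` the inequality is reversed. -/
theorem dressedNorming_lt (κ : Fin N → ℂ) (β : Fin N → EuclideanSpace ℂ (Fin n)) (l : Fin N) :
    dressedNorming κ β (fun m => decide (m < l)) l = betaOut κ β l := by
  have h1 : ((List.finRange N).filter (· ≠ l)).filter (fun m => decide (m < l)) = before l := by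
    rw [List.filter_filter, before]
    exact List.filter_congr fun m _ => by
      rw [Bool.eq_iff_iff]; simpa using fun h : m < l => h.ne
  have h2 : ((List.finRange N).filter (· ≠ l)).filter (fun m => !decide (m < l)) = after l := by
    rw [List.filter_filter, after]
    exact List.filter_congr fun m _ => by
      rw [Bool.eq_iff_iff]; simp; omega
  rw [dressedNorming, betaOut, h1, h2]
  congr 2
  rw [after, ← List.prod_toFinset _ ((List.nodup_finRange N).filter _)]
  refine Finset.prod_congr ?_ fun _ _ => rfl
  ext m
  simp

theorem dressedNorming_gt (κ : Fin N → ℂ) (β : Fin N → EuclideanSpace ℂ (Fin n)) (l : Fin N) :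
    dressedNorming κ β (fun m => decide (l < m)) l = betaIn κ β l := by
  have h1 : ((List.finRange N).filter (· ≠ l)).filter (fun m => decide (l < m)) = after l := by
    rw [List.filter_filter, after]
    exact List.filter_congr fun m _ => by
      rw [Bool.eq_iff_iff]; simpa using fun h : l < m => h.ne'
  have h2 : ((List.finRange N).filter (· ≠ l)).filter (fun m => !decide (l < m)) = before l := by
    rw [List.filter_filter, before]
    exact List.filter_congr fun m _ => by
      rw [Bool.eq_iff_iff]; simp; omega
  rw [dressedNorming, betaIn, h1, h2]
  congr 2
  rw [before, ← List.prod_toFinset _ ((List.nodup_finRange N).filter _)]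
  refine Finset.prod_congr ?_ fun _ _ => rfl
  ext m
  simp

end Asymptotics
end VNLS

theorem proposition2p3 {n N : ℕ} (hN : 2 ≤ N) (u v : Fin N → ℝ) (hv : ∀ j, 0 < v j)
    (hu : StrictMono u) (β : Fin N → EuclideanSpace ℂ (Fin n)) (hβ : ∀ j, β j ≠ 0) :
    let k : Fin N → ℂ := fun j => VNLS.pole (u j) (v j)
    let rate : ℝ := VNLS.minAmplitude v * VNLS.minRelativeSpeed u
    (∀ j, VNLS.betaIn k β j ≠ 0) ∧
    (∀ j, VNLS.betaOut k β j ≠ 0) ∧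
    (∃ C : ℝ, ∀ᶠ t : ℝ in atBot, ∀ x : ℝ,
      ‖VNLS.nSoliton k β x t - ∑ j, VNLS.oneSoliton (u j) (v j) (VNLS.betaIn k β j) x t‖
        ≤ C * Real.exp (-(rate * |t|))) ∧
    (∃ C : ℝ, ∀ᶠ t : ℝ in atTop, ∀ x : ℝ,
      ‖VNLS.nSoliton k β x t - ∑ j, VNLS.oneSoliton (u j) (v j) (VNLS.betaOut k β j) x t‖
        ≤ C * Real.exp (-(rate * |t|))) := by
  intro k rate
  have hκ : ∀ j, 0 < (k j).im := fun j => (VNLS.pole_im (u j) (v j)).symm ▸ half_pos (hv j)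
  have hinj : Function.Injective k := fun i j h => hu.injective <| by
    have := congrArg Complex.re h
    simp only [k, VNLS.pole_re] at this
    linarith
  refine ⟨fun j => ?_, fun j => ?_, ?_, ?_⟩
  · rw [← VNLS.dressedNorming_gt]
    exact VNLS.dressedNorming_ne_zero hκ hinj hβ _ j
  · rw [← VNLS.dressedNorming_lt]
    exact VNLS.dressedNorming_ne_zero hκ hinj hβ _ j
  · obtain ⟨C, hC⟩ := VNLS.exists_norm_nSoliton_sub_le hv hu.injective hβ
      (fun l m => decide (l < m))
    refine ⟨C, ?_⟩
    filter_upwards [eventually_lt_atBot 0] with t ht x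
    simp only [VNLS.dressedNorming_gt] at hC
    -- A mismatch at `m` means that `w_m t` lies between `x` and `w_l t` (possibly equal to `x`), so
    -- `|x - w_l t|` is at least `|w_m - w_l| |t|`. The two cases are the two possible orders of
    -- these points.
    refine hC x t fun l m hml hne => ?_
    refine (mul_le_mul_of_nonneg_right (VNLS.minRelativeSpeed_le u hml) (abs_nonneg t)).trans ?_
    rw [← abs_mul]
    rcases lt_or_gt_of_ne hml with h | h
    · have hlt := mul_lt_mul_of_neg_right (hu h) ht
      have hx : x ≤ VNLS.velocity (u m) * t := by
        by_contra hx
        exact hne (by simp [hx, h.le])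
      simp only [VNLS.velocity] at hx ⊢
      rw [abs_of_nonpos (by linarith), abs_of_nonpos (by linarith)]
      linarith
    · have hlt := mul_lt_mul_of_neg_right (hu h) ht
      have hx : ¬ x ≤ VNLS.velocity (u m) * t := by
        intro hx
        exact hne (by simp [hx, h])
      simp only [VNLS.velocity] at hx ⊢
      rw [abs_of_nonneg (by linarith), abs_of_nonneg (by linarith)]
      linarith
  · obtain ⟨C, hC⟩ := VNLS.exists_norm_nSoliton_sub_le hv hu.injective hβ
      (fun l m => decide (m < l))
    refine ⟨C, ?_⟩
    filter_upwards [eventually_gt_atTop 0] with t ht x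
    simp only [VNLS.dressedNorming_lt] at hC
    -- The same separation argument, with the order of the points `w_j t` reversed because `t > 0`.
    refine hC x t fun l m hml hne => ?_
    refine (mul_le_mul_of_nonneg_right (VNLS.minRelativeSpeed_le u hml) (abs_nonneg t)).trans ?_
    rw [← abs_mul]
    rcases lt_or_gt_of_ne hml with h | h
    · have hlt := mul_lt_mul_of_pos_right (hu h) ht
      have hx : ¬ x ≤ VNLS.velocity (u m) * t := by
        intro hx
        exact hne (by simp [hx, h])
      simp only [VNLS.velocity] at hx ⊢
      rw [abs_of_nonneg (by linarith), abs_of_nonneg (by linarith)]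
      linarith
    · have hlt := mul_lt_mul_of_pos_right (hu h) ht
      have hx : x ≤ VNLS.velocity (u m) * t := by
        by_contra hx
        exact hne (by simp [hx, h.le])
      simp only [VNLS.velocity] at hx ⊢
      rw [abs_of_nonpos (by linarith), abs_of_nonpos (by linarith)]
      linarith
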